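/- Consider the following random graph process. It starts from the graph with a single vertex. At each step, two (not necessarily different) old vertices $u$ and $v$ are selected independently and uniformly at random, independently of the selections in all other steps; a new vertex is added and joined to $u$ and to all neighbours of $u$; after that, all edges incident to $v$ are deleted, without exception (including an edge between $v$ and the new vertex, if there is one). Thus there are $n+1$ vertices after $n$ steps. Then the graph is, after every step, a disjoint union of cliques (each of its connected components is a complete graph). Let $Y[n,k]$ denote the number of these cliques (connected components) of size $k$ after $n$ steps. There is a (deterministic) sequence $(y_k)_{k\ge 1}$ of positive real numbers satisfying \[ y_1=\frac{1+2y_2}{3},\qquad y_k=\frac{(k-1)y_{k-1}+(k+1)y_{k+1}}{2k+1}\quad (k\ge 2), \] such that for every positive integer $k$ \[ \frac{Y[n,k]}{n}\to y_k\quad\text{almost surely as } n\to\infty . \] -/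

import Mathlib

open MeasureTheory ProbabilityTheory Filter Topology
open scoped ENNReal

/-- Duplication of the vertex `u`: the old graph lives on the vertices `0, …, n - 1`; the new vertex
`Fin.last n` is joined to `u` and to all neighbours of `u`. -/
def duplicateVertex {n : ℕ} (G : SimpleGraph (Fin n)) (u : Fin n) : SimpleGraph (Fin (n + 1)) :=
  G.map Fin.castSucc ⊔
    SimpleGraph.fromRel fun a b =>
      a = Fin.last n ∧ ∃ w : Fin n, b = w.castSucc ∧ (w = u ∨ G.Adj u w)

/-- One step: the vertex `u` is duplicated, and then all edges at the old vertex `v` are deleted,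
including a possible edge from `v` to the new vertex. -/
def dupDelStep {n : ℕ} (G : SimpleGraph (Fin n)) (u v : Fin n) : SimpleGraph (Fin (n + 1)) :=
  (duplicateVertex G u).deleteIncidenceSet v.castSucc

/-- The graph after `n` steps (on `n + 1` vertices), started from a single vertex, where
`c n 0` and `c n 1` are the old vertices selected in step `n + 1` for duplication and for
deletion, respectively. -/
def dupDelGraph (c : (n : ℕ) → Fin 2 → Fin (n + 1)) : (n : ℕ) → SimpleGraph (Fin (n + 1))
  | 0 => ⊥
  | n + 1 => dupDelStep (dupDelGraph c n) (c n 0) (c n 1)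

/-- A graph is a disjoint union of cliques if each of its connected components is a clique. -/
def IsDisjointUnionOfCliques {V : Type*} (G : SimpleGraph V) : Prop :=
  ∀ K : G.ConnectedComponent, G.IsClique K.supp

/-- The number of connected components of `G` that are cliques on exactly `k` vertices. -/
noncomputable def numCliques {V : Type*} (G : SimpleGraph V) (k : ℕ) : ℕ :=
  {K : G.ConnectedComponent | G.IsClique K.supp ∧ K.supp.ncard = k}.ncard

/-- The selections are random: for each `n` the two vertices selected in step `n + 1` are uniformly
distributed on the `n + 1` old vertices, and all selections (within a step and over all steps) are
independent. -/
structure IsUniformSelection {Ω : Type*} [MeasurableSpace Ω] (μ : Measure Ω)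
    (C : (n : ℕ) → Fin 2 → Ω → Fin (n + 1)) : Prop where
  measurable : ∀ n i, Measurable (C n i)
  uniform : ∀ n i (a : Fin (n + 1)), μ {ω | C n i ω = a} = 1 / ((n : ℝ≥0∞) + 1)
  indep : iIndepFun (fun p : ℕ × Fin 2 => C p.1 p.2) μ

/-! Count vertices instead of cliques: let X_k(n) be the number of vertices lying in cliques of size
k, so that X_k = k Y[n,k]. Averaging over the two selections, one step changes X_k on average by [k
= 1] + k (X_{k-1} + X_{k+1} - 2 X_k)/(n+1), up to an error O(k²/(n+1))
(`sum_sum_numClosedDegree_dupDelStep`, `abs_meanNumClosedDegree_sub_le_div`). A limit x_k of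
X_k/(n+1) should therefore satisfy x_k = [k = 1] + k (x_{k-1} + x_{k+1} - 2 x_k) with x_0 = 0, and
y_k = x_k/k is the required sequence.

Existence: the homogeneous recurrence has a growing solution p, and reduction of order gives a
second solution p_k ∑_{j≥k} 1/(p_j p_{j+1}), which is positive and bounded by 1 (`boundedSol_eq`,
`boundedSol_le_one`).

Noise: for fixed k the deviations from the conditional mean are bounded and pairwise orthogonal, so
their partial sums are o(n) almost surely (`ae_tendsto_sum_div_of_orthogonal`).

Convergence: the system couples all k, so no induction on k starts. Instead put E_k = limsup |X_k -
(n+1) x_k|/(n+1). The recursion yields (1 + 2k) E_k ≤ k (E_{k-1} + E_{k+1}), so E is convex; being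
bounded and nonnegative with E_0 = 0, it vanishes (`tendsto_div_of_noisy_recursion`). -/

/-! ### The stationary recurrence and its bounded positive solution -/

/-- The solution of `p (k + 1) = (2 + 1 / k) p k - p (k - 1)` with `p 0 = 0`, `p 1 = 1`. -/
noncomputable def growingSol : ℕ → ℝ
  | 0 => 0
  | 1 => 1
  | k + 2 => (2 + 1 / ((k : ℝ) + 1)) * growingSol (k + 1) - growingSol k

theorem growingSol_succ_succ (k : ℕ) :
    growingSol (k + 2) = (2 + 1 / ((k : ℝ) + 1)) * growingSol (k + 1) - growingSol k := by
  rw [growingSol]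

/-- The increments of p are nondecreasing because p ≥ 0. The third clause, a consequence of this
convexity and p 0 = 0, is what makes p k / k monotone. -/
theorem growingSol_aux (k : ℕ) : (k : ℝ) ≤ growingSol k ∧ 1 ≤ growingSol (k + 1) - growingSol k ∧
    growingSol k ≤ k * (growingSol (k + 1) - growingSol k) := by
  induction k with
  | zero => simp [growingSol]
  | succ k ih =>
    obtain ⟨h1, h2, h3⟩ := ih
    have hk : (0 : ℝ) ≤ k := Nat.cast_nonneg k
    have hp : 0 ≤ growingSol (k + 1) := by linarith
    have hd : growingSol (k + 1) - growingSol k ≤ growingSol (k + 1 + 1) - growingSol (k + 1) := by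
      have : 0 ≤ 1 / ((k : ℝ) + 1) * growingSol (k + 1) := by positivity
      rw [growingSol_succ_succ]
      linarith
    push_cast
    refine ⟨by linarith, by linarith, ?_⟩
    calc growingSol (k + 1)
        ≤ ((k : ℝ) + 1) * (growingSol (k + 1) - growingSol k) := by linarith
      _ ≤ _ := by gcongr

theorem le_growingSol (k : ℕ) : (k : ℝ) ≤ growingSol k := (growingSol_aux k).1

theorem growingSol_pos {k : ℕ} (hk : 1 ≤ k) : 0 < growingSol k := by
  have := le_growingSol k
  have : (1 : ℝ) ≤ k := by exact_mod_cast hk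
  linarith

theorem mul_growingSol_le {k j : ℕ} (hkj : k ≤ j) :
    (j : ℝ) * growingSol k ≤ k * growingSol j := by
  rcases Nat.eq_zero_or_pos k with rfl | hk
  · simp [growingSol]
  induction j, hkj using Nat.le_induction with
  | base => exact le_rfl
  | succ j hkj ih =>
    have h3 := (growingSol_aux j).2.2
    have hj : (0 : ℝ) < j := by exact_mod_cast hk.trans_le hkj
    have hk' : (0 : ℝ) < k := by exact_mod_cast hk
    push_cast
    refine le_of_mul_le_mul_left ?_ hj
    calc (j : ℝ) * (((j : ℝ) + 1) * growingSol k) = ((j : ℝ) + 1) * (j * growingSol k) := by ring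
      _ ≤ ((j : ℝ) + 1) * (k * growingSol j) := by gcongr
      _ = k * (j * growingSol j + growingSol j) := by ring
      _ ≤ k * (j * growingSol j + j * (growingSol (j + 1) - growingSol j)) := by gcongr
      _ = _ := by ring

theorem hasSum_one_div_mul_succ {k : ℕ} (hk : 1 ≤ k) :
    HasSum (fun i : ℕ => 1 / (((k + i : ℕ) : ℝ) * ((k + i + 1 : ℕ) : ℝ))) (1 / (k : ℝ)) := by
  have hk' : (0 : ℝ) < k := by exact_mod_cast hk
  rw [hasSum_iff_tendsto_nat_of_nonneg (fun i => by positivity)]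
  have h : ∀ n : ℕ, ∑ i ∈ Finset.range n, 1 / (((k + i : ℕ) : ℝ) * ((k + i + 1 : ℕ) : ℝ))
      = 1 / (k : ℝ) - 1 / ((n : ℝ) + k) := by
    intro n
    induction n with
    | zero => simp
    | succ n ih =>
      rw [Finset.sum_range_succ, ih]
      push_cast
      field_simp
      ring
  simp_rw [h]
  have : Tendsto (fun n : ℕ => 1 / ((n : ℝ) + k)) atTop (𝓝 0) := by
    simp_rw [one_div]
    exact tendsto_inv_atTop_zero.comp (tendsto_atTop_add_const_right _ _ tendsto_natCast_atTop_atTop)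
  simpa using this.const_sub (1 / (k : ℝ))

/-- Monotonicity of p j / j is applied to one factor and the bound p j ≥ j to the other. The
comparison series telescopes to 1 / k, which yields the bound 1 for the bounded solution. -/
theorem growingSol_mul_le {k : ℕ} (hk : 1 ≤ k) (i : ℕ) :
    1 / (growingSol (k + i) * growingSol (k + i + 1)) ≤
      k / growingSol k * (1 / (((k + i : ℕ) : ℝ) * ((k + i + 1 : ℕ) : ℝ))) := by
  have h1 := growingSol_pos hk
  have h2 : 0 < growingSol (k + i) := growingSol_pos (by omega)
  have h3 : 0 < growingSol (k + i + 1) := growingSol_pos (by omega)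
  have h4 := mul_growingSol_le (k := k) (j := k + i) (by omega)
  have h5 := le_growingSol (k + i + 1)
  have hk' : (0 : ℝ) < k := by exact_mod_cast hk
  have h6 : (0 : ℝ) < ((k + i : ℕ) : ℝ) := by exact_mod_cast (by omega : 0 < k + i)
  have h7 : (0 : ℝ) < ((k + i + 1 : ℕ) : ℝ) := by positivity
  rw [div_mul_div_comm, div_le_div_iff₀ (by positivity) (by positivity)]
  calc 1 * (growingSol k * (((k + i : ℕ) : ℝ) * ((k + i + 1 : ℕ) : ℝ)))
      = (((k + i : ℕ) : ℝ) * growingSol k) * ((k + i + 1 : ℕ) : ℝ) := by ring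
    _ ≤ (k * growingSol (k + i)) * growingSol (k + i + 1) := by gcongr
    _ = _ := by ring

/-- The tails `∑_{j ≥ k} 1 / (p j * p (j + 1))`. -/
noncomputable def growingTail (k : ℕ) : ℝ :=
  ∑' i : ℕ, 1 / (growingSol (k + i) * growingSol (k + i + 1))

theorem growingTerm_pos {k : ℕ} (hk : 1 ≤ k) (i : ℕ) :
    0 < 1 / (growingSol (k + i) * growingSol (k + i + 1)) :=
  one_div_pos.2 (mul_pos (growingSol_pos (by omega)) (growingSol_pos (by omega)))

theorem summable_growingTail {k : ℕ} (hk : 1 ≤ k) :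
    Summable fun i : ℕ => 1 / (growingSol (k + i) * growingSol (k + i + 1)) :=
  Summable.of_nonneg_of_le (fun i => (growingTerm_pos hk i).le) (growingSol_mul_le hk)
    ((hasSum_one_div_mul_succ hk).summable.mul_left _)

theorem growingTail_succ {k : ℕ} (hk : 1 ≤ k) :
    growingTail k = 1 / (growingSol k * growingSol (k + 1)) + growingTail (k + 1) := by
  unfold growingTail
  rw [(summable_growingTail hk).tsum_eq_zero_add]
  simp only [add_zero]
  congr 2
  ext i
  rw [show k + (i + 1) = k + 1 + i by ring]

/-- The bounded solution of `x (k - 1) + x (k + 1) = (2 + 1 / k) x k`, normalised by the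
boundary condition `3 x 1 = 1 + x 2`; its value at `0` is set to `0`. -/
noncomputable def boundedSol (k : ℕ) : ℝ := growingSol k * growingTail k

theorem boundedSol_zero : boundedSol 0 = 0 := by simp [boundedSol, growingSol]

theorem boundedSol_pos {k : ℕ} (hk : 1 ≤ k) : 0 < boundedSol k :=
  mul_pos (growingSol_pos hk)
    ((summable_growingTail hk).tsum_pos (fun i => (growingTerm_pos hk i).le) 0
      (growingTerm_pos hk 0))

theorem boundedSol_le_one (k : ℕ) : boundedSol k ≤ 1 := by
  rcases Nat.eq_zero_or_pos k with rfl | hk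
  · simp [boundedSol_zero]
  have hs := (hasSum_one_div_mul_succ hk).mul_left (k / growingSol k)
  have h : growingTail k ≤ k / growingSol k * (1 / k) :=
    ((summable_growingTail hk).tsum_le_tsum (growingSol_mul_le hk) hs.summable).trans_eq hs.tsum_eq
  have hp := growingSol_pos hk
  have hk' : (0 : ℝ) < k := by exact_mod_cast hk
  calc boundedSol k ≤ growingSol k * (k / growingSol k * (1 / k)) := by
        unfold boundedSol; gcongr
    _ = 1 := by field_simp

theorem boundedSol_one : 3 * boundedSol 1 = 1 + boundedSol 2 := by
  have h2 : growingSol 2 = 3 := by norm_num [growingSol]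
  have h1 : growingSol 1 = 1 := by simp [growingSol]
  have := growingTail_succ (le_refl 1)
  norm_num [h1, h2] at this
  simp only [boundedSol, h1, h2]
  linarith

/-- Rewriting both outer tails through the tail at k + 1 produces two terms 1 / p (k + 1) of
opposite sign; what remains is the recurrence of p multiplied by that tail. -/
theorem boundedSol_succ_succ {k : ℕ} (hk : 1 ≤ k) :
    boundedSol k + boundedSol (k + 2) = (2 + 1 / ((k : ℝ) + 1)) * boundedSol (k + 1) := by
  have h1 := growingSol_pos hk
  have h2 : 0 < growingSol (k + 1) := growingSol_pos (by omega)
  have h3 : 0 < growingSol (k + 2) := growingSol_pos (by omega)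
  have e1 : growingSol k * growingTail k
      = 1 / growingSol (k + 1) + growingSol k * growingTail (k + 1) := by
    rw [growingTail_succ hk]; field_simp
  have e2 : growingSol (k + 2) * growingTail (k + 1)
      = 1 / growingSol (k + 1) + growingSol (k + 2) * growingTail (k + 2) := by
    rw [growingTail_succ (by omega : 1 ≤ k + 1)]; field_simp
  have e3 := congrArg (· * growingTail (k + 1)) (growingSol_succ_succ k)
  simp only [boundedSol] at *
  linarith

theorem boundedSol_eq {k : ℕ} (hk : 1 ≤ k) :
    boundedSol k = (if k = 1 then 1 else 0)
      + k * (boundedSol (k - 1) + boundedSol (k + 1) - 2 * boundedSol k) := by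
  rcases k with _ | _ | k
  · omega
  · have := boundedSol_one
    simp [boundedSol_zero]
    linarith
  · have := boundedSol_succ_succ (k := k + 1) (by omega)
    simp only [add_assoc] at *
    norm_num at *
    push_cast at *
    have hk : (0 : ℝ) ≤ k := Nat.cast_nonneg k
    rw [this]
    field_simp
    ring

/-! ### Deterministic analysis of the perturbed recursion -/

/-- With β = B / (1 + c), the sequence β (n + 1) solves the recursion exactly for constant forcing
B. The excess of w over it is multiplied by a factor in [0, 1] for large n, so it stays below a
constant, which ε (n + 1) absorbs. -/
theorem eventually_le_of_recursive_le {w b : ℕ → ℝ} {c B ε : ℝ} (hc : 0 ≤ c)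
    (hw : ∀ᶠ n : ℕ in atTop, w (n + 1) ≤ (1 - c / ((n : ℝ) + 1)) * w n + b n)
    (hb : ∀ᶠ n in atTop, b n ≤ B) (hε : 0 < ε) :
    ∀ᶠ n : ℕ in atTop, w n ≤ (B / (1 + c) + ε) * ((n : ℝ) + 1) := by
  have hcn : ∀ᶠ n : ℕ in atTop, c ≤ (n : ℝ) := tendsto_natCast_atTop_atTop.eventually_ge_atTop c
  obtain ⟨n₀, hn₀⟩ := eventually_atTop.1 (hw.and (hb.and hcn))
  set β := B / (1 + c) with hβ
  have hβB : β * (1 + c) = B := by rw [hβ]; field_simp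
  set A := max (w n₀ - β * ((n₀ : ℝ) + 1)) 0 with hA
  have key : ∀ n, n₀ ≤ n → w n - β * ((n : ℝ) + 1) ≤ A := by
    intro n hn
    induction n, hn using Nat.le_induction with
    | base => exact le_max_left _ _
    | succ n hn ih =>
      obtain ⟨h1, h2, h3⟩ := hn₀ n hn
      have hn1 : (0 : ℝ) < (n : ℝ) + 1 := by positivity
      have hq0 : 0 ≤ 1 - c / ((n : ℝ) + 1) := by
        rw [sub_nonneg, div_le_one hn1]; linarith
      have hq1 : 1 - c / ((n : ℝ) + 1) ≤ 1 := by
        rw [sub_le_self_iff]; positivity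
      have hA0 : 0 ≤ A := le_max_right _ _
      have e : (1 - c / ((n : ℝ) + 1)) * (β * ((n : ℝ) + 1)) = β * ((n : ℝ) + 1) - c * β := by
        field_simp
      push_cast
      calc w (n + 1) - β * ((n : ℝ) + 1 + 1)
          ≤ (1 - c / ((n : ℝ) + 1)) * w n + B - β * ((n : ℝ) + 1 + 1) := by linarith
        _ = (1 - c / ((n : ℝ) + 1)) * (w n - β * ((n : ℝ) + 1)) := by
          rw [mul_sub, e, ← hβB]; ring
        _ ≤ (1 - c / ((n : ℝ) + 1)) * A := by gcongr
        _ ≤ 1 * A := by gcongr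
        _ = A := one_mul A
  filter_upwards [eventually_ge_atTop n₀,
    tendsto_natCast_atTop_atTop.eventually_ge_atTop (A / ε)] with n hn hn'
  have := key n hn
  rw [div_le_iff₀ hε] at hn'
  linarith

/-- A convex sequence with one positive increment grows at least linearly from there on, so
boundedness forces it to be nonincreasing from its value 0. -/
theorem eq_zero_of_bounded_of_midpoint_convex {E : ℕ → ℝ} {C : ℝ} (h0 : E 0 = 0)
    (hE : ∀ k, 0 ≤ E k) (hC : ∀ k, E k ≤ C)
    (hconv : ∀ k, 2 * E (k + 1) ≤ E k + E (k + 2)) (k : ℕ) : E k = 0 := by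
  have hmono : Monotone fun k => E (k + 1) - E k :=
    monotone_nat_of_le_succ fun k => by have := hconv k; simp only [add_assoc]; norm_num; linarith
  have hstep : ∀ j, E (j + 1) - E j ≤ 0 := by
    intro j
    by_contra! hj
    have hlin : ∀ i : ℕ, i * (E (j + 1) - E j) ≤ E (j + i) := by
      intro i
      induction i with
      | zero => simpa using hE j
      | succ i ih =>
        have := hmono (Nat.le_add_right j i)
        simp only [← add_assoc] at this ⊢
        push_cast
        linarith
    obtain ⟨i, hi⟩ := exists_nat_gt (C / (E (j + 1) - E j))
    rw [div_lt_iff₀ hj] at hi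
    linarith [hlin i, hC (j + i)]
  have : E k ≤ E 0 := antitone_nat_of_succ_le (fun j => by linarith [hstep j]) (Nat.zero_le k)
  linarith [hE k]

theorem tendsto_div_of_noisy_recursion {X e ξ : ℕ → ℕ → ℝ} {x K : ℕ → ℝ} {C : ℝ}
    (hx0 : x 0 = 0) (hxC : ∀ k, |x k| ≤ C)
    (hx : ∀ k, 1 ≤ k → x k = (if k = 1 then 1 else 0) + k * (x (k - 1) + x (k + 1) - 2 * x k))
    (hX0 : ∀ n, X 0 n = 0) (hXC : ∀ k n, |X k n| ≤ (n : ℝ) + 1)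
    (hX : ∀ k n, 1 ≤ k → X k (n + 1) = X k n + (if k = 1 then 1 else 0)
      + k * (X (k - 1) n + X (k + 1) n - 2 * X k n) / ((n : ℝ) + 1) + e k n + ξ k n)
    (he : ∀ k n, 1 ≤ k → |e k n| ≤ K k / ((n : ℝ) + 1))
    (hξ : ∀ k, 1 ≤ k → Tendsto (fun n : ℕ => (∑ m ∈ Finset.range n, ξ k m) / (n : ℝ)) atTop (𝓝 0))
    (k : ℕ) :
    Tendsto (fun n : ℕ => X k n / ((n : ℝ) + 1)) atTop (𝓝 (x k)) := by
  set d : ℕ → ℕ → ℝ := fun k n => X k n - ((n : ℝ) + 1) * x k with hd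
  set M : ℕ → ℕ → ℝ := fun k n => ∑ m ∈ Finset.range n, ξ k m with hM
  set E : ℕ → ℝ := fun k => limsup (fun n : ℕ => |d k n| / ((n : ℝ) + 1)) atTop with hEdef
  have hpos : ∀ n : ℕ, (0 : ℝ) < (n : ℝ) + 1 := fun n => by positivity
  have hdC : ∀ k n, |d k n| ≤ (1 + C) * ((n : ℝ) + 1) := by
    intro k n
    calc |d k n| ≤ |X k n| + |((n : ℝ) + 1) * x k| := abs_sub _ _
      _ ≤ ((n : ℝ) + 1) + ((n : ℝ) + 1) * C := by
        rw [abs_mul, abs_of_pos (hpos n)]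
        have := hpos n
        gcongr
        exacts [hXC k n, hxC k]
      _ = _ := by ring
  have hq0 : ∀ k n, 0 ≤ |d k n| / ((n : ℝ) + 1) := fun k n => by positivity
  have hqC : ∀ k n, |d k n| / ((n : ℝ) + 1) ≤ 1 + C := fun k n => by
    rw [div_le_iff₀ (hpos n)]; exact hdC k n
  have hbdd : ∀ k, IsBoundedUnder (· ≤ ·) atTop fun n : ℕ => |d k n| / ((n : ℝ) + 1) :=
    fun k => isBoundedUnder_of ⟨1 + C, hqC k⟩
  have hcobdd : ∀ k, IsCoboundedUnder (· ≤ ·) atTop fun n : ℕ => |d k n| / ((n : ℝ) + 1) :=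
    fun k => (isBoundedUnder_of ⟨0, hq0 k⟩ : IsBoundedUnder (· ≥ ·) _ _).isCoboundedUnder_le
  have hElt : ∀ k (ε : ℝ), 0 < ε → ∀ᶠ n : ℕ in atTop, |d k n| / ((n : ℝ) + 1) ≤ E k + ε := by
    intro k ε hε
    filter_upwards [eventually_lt_of_limsup_lt (show E k < E k + ε by linarith) (hbdd k)]
      with n hn using hn.le
  have hEle : ∀ k B, (∀ᶠ n : ℕ in atTop, |d k n| / ((n : ℝ) + 1) ≤ B) → E k ≤ B :=
    fun k B h => limsup_le_of_le (hcobdd k) h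
  have hEC : ∀ k, E k ≤ 1 + C := fun k => hEle k _ (Eventually.of_forall (hqC k))
  have hE0 : ∀ k, 0 ≤ E k := fun k =>
    le_limsup_of_frequently_le (Frequently.of_forall (hq0 k)) (hbdd k)
  have hM0 : ∀ k, 1 ≤ k → ∀ ε > 0, ∀ᶠ n : ℕ in atTop, |M k n| / ((n : ℝ) + 1) ≤ ε := by
    intro k hk ε hε
    filter_upwards [(hξ k hk).eventually (Metric.ball_mem_nhds 0 hε), eventually_ge_atTop 1]
      with n hn hn1
    have hn0 : (0 : ℝ) < n := by exact_mod_cast hn1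
    rw [dist_zero_right, Real.norm_eq_abs, abs_div, abs_of_pos hn0,
      div_lt_iff₀ hn0] at hn
    rw [div_le_iff₀ (hpos n)]
    linarith
  have hconv : ∀ k : ℕ, 1 ≤ k → (1 + 2 * (k : ℝ)) * E k ≤ k * (E (k - 1) + E (k + 1)) := by
    intro k hk
    have hk0 : (0 : ℝ) < k := by exact_mod_cast hk
    refine le_of_forall_pos_le_add fun δ hδ => ?_
    -- The total loss is (4k + 1) ε from the forcing bound, plus 2 (1 + 2k) ε from the slack in the
    -- recursion lemma and from adding the noise sum back.
    obtain ⟨ε, hε, hεδ⟩ : ∃ ε > 0, (8 * (k : ℝ) + 3) * ε ≤ δ :=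
      ⟨δ / (8 * k + 3), by positivity, by field_simp; exact le_rfl⟩
    set b : ℕ → ℝ := fun n => k * (|d (k - 1) n| / ((n : ℝ) + 1) + |d (k + 1) n| / ((n : ℝ) + 1))
      + 2 * k * (|M k n| / ((n : ℝ) + 1)) + K k / ((n : ℝ) + 1) with hb
    -- Subtracting the accumulated noise M removes the individual noise terms, which need not be
    -- small; only M / (n + 1) enters, and it tends to 0.
    have hrec : ∀ᶠ n : ℕ in atTop, |d k (n + 1) - M k (n + 1)|
        ≤ (1 - 2 * (k : ℝ) / ((n : ℝ) + 1)) * |d k n - M k n| + b n := by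
      filter_upwards [tendsto_natCast_atTop_atTop.eventually_ge_atTop (2 * (k : ℝ))] with n hn
      have hn1 := hpos n
      have hq : 0 ≤ 1 - 2 * (k : ℝ) / ((n : ℝ) + 1) := by
        rw [sub_nonneg, div_le_one hn1]; linarith
      have hid : d k (n + 1) - M k (n + 1)
          = (1 - 2 * (k : ℝ) / ((n : ℝ) + 1)) * (d k n - M k n)
            + (k * (d (k - 1) n / ((n : ℝ) + 1) + d (k + 1) n / ((n : ℝ) + 1))
              + (-(2 * k * (M k n / ((n : ℝ) + 1))) + e k n)) := by
        simp only [hd, hM, Finset.sum_range_succ, hX k n hk]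
        have h2 := hx k hk
        push_cast
        field_simp
        linear_combination -((n : ℝ) + 1) * h2
      rw [hid]
      refine (abs_add_le _ _).trans ?_
      rw [abs_mul, abs_of_nonneg hq]
      refine add_le_add le_rfl ?_
      refine (abs_add_le _ _).trans ?_
      simp only [hb]
      rw [add_assoc]
      refine add_le_add ?_ ((abs_add_le _ _).trans (add_le_add ?_ (he k n hk)))
      · rw [abs_mul, abs_of_pos hk0]
        gcongr
        refine (abs_add_le _ _).trans ?_
        rw [abs_div, abs_div, abs_of_pos hn1]
      · rw [abs_neg, abs_mul, abs_div, abs_of_pos hn1, abs_of_pos (by positivity)]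
    have hKlim : ∀ᶠ n : ℕ in atTop, K k / ((n : ℝ) + 1) ≤ ε := by
      filter_upwards [tendsto_natCast_atTop_atTop.eventually_ge_atTop (K k / ε)] with n hn
      rw [div_le_iff₀ hε] at hn
      rw [div_le_iff₀ (hpos n)]
      linarith
    have hbB : ∀ᶠ n in atTop, b n ≤ k * ((E (k - 1) + ε) + (E (k + 1) + ε)) + 2 * k * ε + ε := by
      filter_upwards [hElt (k - 1) ε hε, hElt (k + 1) ε hε, hM0 k hk ε hε, hKlim]
        with n h1 h2 h3 h4
      simp only [hb]
      gcongr
    have hw := eventually_le_of_recursive_le (w := fun n => |d k n - M k n|) (by positivity)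
      hrec hbB hε
    have hfin := hEle k _ (by
      filter_upwards [hw, hM0 k hk ε hε] with n h1 h2
      have : |d k n| ≤ |d k n - M k n| + |M k n| := by
        simpa using abs_add_le (d k n - M k n) (M k n)
      calc |d k n| / ((n : ℝ) + 1) ≤ (|d k n - M k n| + |M k n|) / ((n : ℝ) + 1) := by
            have := hpos n
            gcongr
        _ = |d k n - M k n| / ((n : ℝ) + 1) + |M k n| / ((n : ℝ) + 1) := add_div _ _ _
        _ ≤ _ := add_le_add ((div_le_iff₀ (hpos n)).2 h1) h2)
    have h12 : (0 : ℝ) < 1 + 2 * k := by positivity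
    calc (1 + 2 * (k : ℝ)) * E k ≤ _ := mul_le_mul_of_nonneg_left hfin h12.le
      _ = k * (E (k - 1) + E (k + 1)) + (8 * k + 3) * ε := by field_simp; ring
      _ ≤ _ := by nlinarith
  have hEk : E k = 0 := by
    refine eq_zero_of_bounded_of_midpoint_convex ?_ hE0 hEC (fun k => ?_) k
    · simp [hEdef, hd, hX0, hx0]
    -- Dropping the nonnegative extra term E (k + 1) from the left side leaves midpoint convexity.
    · have h := hconv (k + 1) (by omega)
      simp only [Nat.add_sub_cancel, add_assoc] at h
      norm_num at h
      have h1 := hE0 (k + 1)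
      have hk : (0 : ℝ) < (k : ℝ) + 1 := by positivity
      refine le_of_mul_le_mul_left ?_ hk
      linarith
  rw [Metric.tendsto_atTop']
  intro ε hε
  obtain ⟨n₀, hn₀⟩ := eventually_atTop.1 (hElt k (ε / 2) (by positivity))
  refine ⟨n₀, fun n hn => ?_⟩
  have := hn₀ n hn.le
  rw [hEk, zero_add] at this
  rw [Real.dist_eq]
  have h2 : X k n / ((n : ℝ) + 1) - x k = d k n / ((n : ℝ) + 1) := by
    have := hpos n
    simp only [hd]; field_simp
  rw [h2, abs_div, abs_of_pos (hpos n)]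
  linarith

/-! ### A strong law for bounded orthogonal variables -/

theorem integral_sum_sq_le_of_orthogonal {Ω : Type*} [MeasurableSpace Ω] {μ : Measure Ω}
    [IsProbabilityMeasure μ] {ξ : ℕ → Ω → ℝ} {B : ℝ} (hm : ∀ n, Measurable (ξ n))
    (hB : ∀ n ω, |ξ n ω| ≤ B) (horth : ∀ i j, i < j → ∫ ω, ξ i ω * ξ j ω ∂μ = 0) (n : ℕ) :
    ∫ ω, (∑ m ∈ Finset.range n, ξ m ω) ^ 2 ∂μ ≤ n * B ^ 2 := by
  have hint : ∀ i j, Integrable (fun ω => ξ i ω * ξ j ω) μ := fun i j =>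
    Integrable.of_bound ((hm i).mul (hm j)).aestronglyMeasurable (B * B)
      (Eventually.of_forall fun ω => by
        rw [norm_mul]
        exact mul_le_mul (hB i ω) (hB j ω) (norm_nonneg _) ((abs_nonneg _).trans (hB i ω)))
  have h1 : ∀ ω, (∑ m ∈ Finset.range n, ξ m ω) ^ 2
      = ∑ i ∈ Finset.range n, ∑ j ∈ Finset.range n, ξ i ω * ξ j ω := fun ω => by
    rw [sq, Finset.sum_mul_sum]
  simp_rw [h1]
  rw [integral_finsetSum _ fun i _ => integrable_finsetSum _ fun j _ => hint i j]
  have h2 : ∀ i ∈ Finset.range n, ∫ ω, ∑ j ∈ Finset.range n, ξ i ω * ξ j ω ∂μ ≤ B ^ 2 := by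
    intro i hi
    rw [integral_finsetSum _ fun j _ => hint i j, Finset.sum_eq_single_of_mem i hi]
    · calc ∫ ω, ξ i ω * ξ i ω ∂μ ≤ ∫ _, B ^ 2 ∂μ := by
            refine integral_mono (hint i i) (integrable_const _) fun ω => ?_
            simp only [← sq]
            exact sq_le_sq' (abs_le.1 (hB i ω)).1 (abs_le.1 (hB i ω)).2
        _ = B ^ 2 := by simp
    · intro j _ hji
      rcases lt_or_gt_of_ne hji with h | h
      · simp_rw [mul_comm (ξ i _)]
        exact horth j i h
      · exact horth i j h
  simpa using Finset.sum_le_card_nsmul _ _ _ h2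

/-- A strong law of large numbers for uniformly bounded, pairwise orthogonal random variables. -/
theorem ae_tendsto_sum_div_of_orthogonal {Ω : Type*} [MeasurableSpace Ω] {μ : Measure Ω}
    [IsProbabilityMeasure μ] {ξ : ℕ → Ω → ℝ} {B : ℝ} (hm : ∀ n, Measurable (ξ n))
    (hB : ∀ n ω, |ξ n ω| ≤ B) (horth : ∀ i j, i < j → ∫ ω, ξ i ω * ξ j ω ∂μ = 0) :
    ∀ᵐ ω ∂μ, Tendsto (fun n : ℕ => (∑ m ∈ Finset.range n, ξ m ω) / (n : ℝ)) atTop (𝓝 0) := by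
  set M : ℕ → Ω → ℝ := fun n ω => ∑ m ∈ Finset.range n, ξ m ω with hM
  have hB0 : 0 ≤ B := by
    obtain ⟨ω⟩ : Nonempty Ω := nonempty_of_isProbabilityMeasure μ
    exact (abs_nonneg _).trans (hB 0 ω)
  have hMm : ∀ n, Measurable (M n) := fun n => Finset.measurable_fun_sum _ fun i _ => hm i
  have hMabs : ∀ n ω, |M n ω| ≤ n * B := fun n ω => by
    refine (Finset.abs_sum_le_sum_abs _ _).trans ?_
    simpa using Finset.sum_le_card_nsmul (Finset.range n) (fun m => |ξ m ω|) B fun m _ => hB m ω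
  have hMint : ∀ n, Integrable (fun ω => M n ω ^ 2) μ := fun n =>
    Integrable.of_bound ((hMm n).pow_const 2).aestronglyMeasurable ((n * B) ^ 2)
      (Eventually.of_forall fun ω => by
        rw [norm_pow]
        exact pow_le_pow_left₀ (norm_nonneg _) (hMabs n ω) 2)
  -- Along the squares the second moments of the averages are O(1 / n²), hence summable, which gives
  -- almost sure convergence on this subsequence.
  have hlin : ∀ n : ℕ, ∫⁻ ω, ENNReal.ofReal ((M (n ^ 2) ω / ((n : ℝ) ^ 2)) ^ 2) ∂μ
      ≤ ENNReal.ofReal (B ^ 2 * (1 / (n : ℝ) ^ 2)) := by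
    intro n
    rw [← ofReal_integral_eq_lintegral_ofReal]
    · refine ENNReal.ofReal_le_ofReal ?_
      simp_rw [div_pow]
      rw [integral_div]
      rcases Nat.eq_zero_or_pos n with rfl | hn
      · simp
      have hn' : (0 : ℝ) < n := by exact_mod_cast hn
      have := integral_sum_sq_le_of_orthogonal hm hB horth (n ^ 2)
      push_cast at this
      rw [div_le_iff₀ (by positivity)]
      refine this.trans_eq ?_
      field_simp
    · simp_rw [div_pow]
      exact (hMint _).div_const _
    · exact Eventually.of_forall fun ω => sq_nonneg _
  have hmeas : ∀ n : ℕ, Measurable fun ω => ENNReal.ofReal ((M (n ^ 2) ω / ((n : ℝ) ^ 2)) ^ 2) :=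
    fun n => (((hMm _).div_const _).pow_const 2).ennreal_ofReal
  have hsum : ∫⁻ ω, ∑' n : ℕ, ENNReal.ofReal ((M (n ^ 2) ω / ((n : ℝ) ^ 2)) ^ 2) ∂μ ≠ ∞ := by
    rw [lintegral_tsum fun n => (hmeas n).aemeasurable]
    refine ne_top_of_le_ne_top ?_ (ENNReal.tsum_le_tsum hlin)
    exact ((Real.summable_one_div_nat_pow.2 one_lt_two).mul_left _).tsum_ofReal_ne_top
  filter_upwards [ae_lt_top (Measurable.tsum hmeas) hsum] with ω hω
  have hsq : Tendsto (fun n : ℕ => M (n ^ 2) ω / ((n : ℝ) ^ 2)) atTop (𝓝 0) := by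
    have h1 := ENNReal.tendsto_atTop_zero_of_tsum_ne_top hω.ne
    have h2 := (ENNReal.tendsto_toReal ENNReal.zero_ne_top).comp h1
    simp only [Function.comp_def, ENNReal.toReal_zero, ENNReal.toReal_ofReal (sq_nonneg _)] at h2
    have h3 := h2.sqrt
    simp only [Real.sqrt_sq_eq_abs, Real.sqrt_zero] at h3
    exact (tendsto_zero_iff_abs_tendsto_zero _).2 h3
  have hsqrt : Tendsto (fun n : ℕ => Nat.sqrt n) atTop atTop :=
    tendsto_atTop.2 fun b => by
      filter_upwards [eventually_ge_atTop (b * b)] with n hn using Nat.le_sqrt.2 hn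
  have hbound : Tendsto (fun n : ℕ => |M (Nat.sqrt n ^ 2) ω / ((Nat.sqrt n : ℝ) ^ 2)|
      + 2 * B * ((Nat.sqrt n : ℝ))⁻¹) atTop (𝓝 0) := by
    have h1 := (hsq.comp hsqrt).abs
    have h2 := (tendsto_inv_atTop_zero.comp
      (tendsto_natCast_atTop_atTop (R := ℝ) |>.comp hsqrt)).const_mul (2 * B)
    simpa using h1.add h2
  refine squeeze_zero_norm' ?_ hbound
  filter_upwards [eventually_ge_atTop 1] with n hn
  set s := Nat.sqrt n with hs
  have hs1 : 1 ≤ s := Nat.le_sqrt.2 (by simpa using hn)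
  have hle : s ^ 2 ≤ n := Nat.sqrt_le' n
  -- Fewer than 2s + 1 steps separate n from the preceding square, so boundedness of the summands
  -- controls the change in the sum by O(√n).
  have hlt : n ≤ s ^ 2 + 2 * s := by
    have := Nat.sqrt_le_add n
    rw [← hs] at this
    nlinarith
  have hdiff : |M n ω - M (s ^ 2) ω| ≤ 2 * s * B := by
    simp only [hM]
    rw [← Finset.sum_Ico_eq_sub _ hle]
    refine (Finset.abs_sum_le_sum_abs _ _).trans ?_
    refine (Finset.sum_le_card_nsmul _ _ B fun m _ => hB m ω).trans ?_
    rw [Nat.card_Ico, nsmul_eq_mul]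
    have : ((n - s ^ 2 : ℕ) : ℝ) ≤ 2 * s := by exact_mod_cast (by omega : n - s ^ 2 ≤ 2 * s)
    gcongr
  have hs0 : (0 : ℝ) < s := by exact_mod_cast hs1
  have hn0 : (s : ℝ) ^ 2 ≤ n := by exact_mod_cast hle
  have hn1 : (0 : ℝ) < n := lt_of_lt_of_le (by positivity) hn0
  have htri : |M n ω| ≤ |M (s ^ 2) ω| + 2 * s * B := by
    have := abs_add_le (M (s ^ 2) ω) (M n ω - M (s ^ 2) ω)
    rw [add_sub_cancel] at this
    linarith
  change ‖M n ω / n‖ ≤ _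
  rw [Real.norm_eq_abs, abs_div, abs_of_pos hn1, abs_div, abs_of_pos (by positivity : (0:ℝ) < s ^ 2)]
  calc |M n ω| / n ≤ (|M (s ^ 2) ω| + 2 * s * B) / (s : ℝ) ^ 2 := by gcongr
    _ = _ := by field_simp

/-! ### Cluster graphs and counting vertices by clique size -/

/-- The relation of being equal or adjacent. -/
def EqOrAdj {V : Type*} (G : SimpleGraph V) (a b : V) : Prop := a = b ∨ G.Adj a b

open scoped Classical in
/-- The number of vertices that are equal or adjacent to `w`. -/
noncomputable def closedDegree {V : Type*} [Fintype V] (G : SimpleGraph V) (w : V) : ℕ :=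
  (Finset.univ.filter fun b => EqOrAdj G w b).card

/-- The number of vertices of closed degree `k`. -/
noncomputable def numClosedDegree {V : Type*} [Fintype V] (G : SimpleGraph V) (k : ℕ) : ℕ :=
  (Finset.univ.filter fun w => closedDegree G w = k).card

/-- Adjacency, or equality, is a transitive relation. -/
def IsClusterGraph {V : Type*} (G : SimpleGraph V) : Prop :=
  ∀ a b c, G.Adj a b → G.Adj b c → a ≠ c → G.Adj a c

section Cluster

variable {V : Type*} {G : SimpleGraph V}

theorem IsClusterGraph.reachable_iff (hG : IsClusterGraph G) (a b : V) :
    G.Reachable a b ↔ EqOrAdj G a b := by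
  constructor
  · rintro ⟨p⟩
    induction p with
    | nil => exact Or.inl rfl
    | @cons x y z h p ih =>
      rcases eq_or_ne x z with hxz | hxz
      · exact Or.inl hxz
      · rcases ih with rfl | ih
        · exact Or.inr h
        · exact Or.inr (hG _ _ _ h ih hxz)
  · rintro (rfl | h)
    exacts [SimpleGraph.Reachable.refl _, h.reachable]

theorem IsClusterGraph.isDisjointUnionOfCliques (hG : IsClusterGraph G) :
    IsDisjointUnionOfCliques G := by
  intro K a ha b hb hab
  rw [SimpleGraph.ConnectedComponent.mem_supp_iff] at ha hb
  have h := SimpleGraph.ConnectedComponent.exact (ha.trans hb.symm)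
  exact ((hG.reachable_iff a b).1 h).resolve_left hab

variable [Fintype V]

theorem IsClusterGraph.ncard_supp (hG : IsClusterGraph G) (w : V) :
    (G.connectedComponentMk w).supp.ncard = closedDegree G w := by
  rw [closedDegree, ← Set.ncard_coe_finset]
  congr 1
  ext b
  simp only [SimpleGraph.ConnectedComponent.mem_supp_iff, SimpleGraph.ConnectedComponent.eq,
    Finset.coe_filter, Finset.mem_univ, true_and, Set.mem_ofPred_eq]
  rw [SimpleGraph.reachable_comm]
  exact hG.reachable_iff w b

theorem IsClusterGraph.closedDegree_eq (hG : IsClusterGraph G) {a b : V}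
    (h : EqOrAdj G a b) : closedDegree G a = closedDegree G b := by
  rw [← hG.ncard_supp, ← hG.ncard_supp,
    SimpleGraph.ConnectedComponent.sound ((hG.reachable_iff a b).2 h)]

/-- Each clique of size k is the fibre of the map from vertices to components and contributes k
vertices. This passes between Y[n,k] and the vertex counts. -/
theorem IsClusterGraph.numCliques_mul (hG : IsClusterGraph G) (k : ℕ) :
    numCliques G k * k = numClosedDegree G k := by
  classical
  have := Fintype.ofFinite G.ConnectedComponent
  set S : Finset G.ConnectedComponent := Finset.univ.filter fun K => K.supp.ncard = k with hS
  have h1 : numCliques G k = S.card := by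
    rw [numCliques, ← Set.ncard_coe_finset]
    congr 1
    ext K
    simp [hS, hG.isDisjointUnionOfCliques K]
  rw [h1, numClosedDegree, Finset.card_eq_sum_card_fiberwise
    (f := G.connectedComponentMk) (t := S)]
  · rw [Finset.sum_const_nat (m := k)]
    intro K hK
    have hK' : K.supp.ncard = k := by simpa [hS] using hK
    rw [← hK', ← Set.ncard_coe_finset]
    congr 1
    ext w
    simp only [Finset.coe_filter, Finset.mem_filter, Finset.mem_univ, true_and, Set.mem_ofPred_eq,
      SimpleGraph.ConnectedComponent.mem_supp_iff, and_iff_right_iff_imp]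
    rintro rfl
    rw [← hG.ncard_supp]
  · intro w hw
    simp only [Finset.coe_filter, Finset.mem_univ, true_and, Set.mem_ofPred_eq, hS] at hw ⊢
    rw [hG.ncard_supp, hw]

theorem one_le_closedDegree (w : V) : 1 ≤ closedDegree G w := by
  classical
  exact Finset.card_pos.2 ⟨w, Finset.mem_filter.2 ⟨Finset.mem_univ _, Or.inl rfl⟩⟩

theorem numClosedDegree_zero : numClosedDegree G 0 = 0 := by
  rw [numClosedDegree, Finset.card_eq_zero, Finset.filter_eq_empty_iff]
  intro w _ h
  have := one_le_closedDegree (G := G) w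
  omega

theorem numClosedDegree_le (k : ℕ) : numClosedDegree G k ≤ Fintype.card V :=
  Finset.card_le_univ _

open scoped Classical in
theorem sum_ite_closedDegree (w : V) (a b : ℝ) :
    ∑ u : V, (if EqOrAdj G w u then a else b)
      = closedDegree G w * a + ((Fintype.card V : ℝ) - closedDegree G w) * b := by
  have h : ∀ u : V, (if EqOrAdj G w u then a else b)
      = (if EqOrAdj G w u then 1 else 0) * (a - b) + b := fun u => by split_ifs <;> ring
  simp_rw [h]
  rw [Finset.sum_add_distrib, ← Finset.sum_mul, Finset.sum_boole, ← closedDegree]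
  simp
  ring

theorem sum_ite_closedDegree_eq (j : ℕ) (φ : ℕ → ℝ) :
    ∑ w : V, (if closedDegree G w = j then 1 else 0) * φ (closedDegree G w)
      = numClosedDegree G j * φ j := by
  rw [numClosedDegree, Finset.card_filter]
  push_cast
  rw [Finset.sum_mul]
  refine Finset.sum_congr rfl fun w _ => ?_
  split_ifs with h
  · rw [h]
  · simp

end Cluster

/-! ### Effect of one step on adjacency and closed degrees -/

section Step

variable {n : ℕ} (G : SimpleGraph (Fin n)) (u v : Fin n)

theorem dupDelStep_adj_castSucc (a b : Fin n) :
    (dupDelStep G u v).Adj a.castSucc b.castSucc ↔ G.Adj a b ∧ a ≠ v ∧ b ≠ v := by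
  simp only [dupDelStep, duplicateVertex, SimpleGraph.deleteIncidenceSet_adj,
    SimpleGraph.sup_adj, SimpleGraph.map_adj', SimpleGraph.fromRel_adj]
  constructor
  · rintro ⟨⟨_, a', b', h, ha, hb⟩ | ⟨_, ⟨h, _⟩ | ⟨h, _⟩⟩, h1, h2⟩
    · have ha := Fin.castSucc_injective _ ha
      have hb := Fin.castSucc_injective _ hb
      subst ha hb
      exact ⟨h, fun h => h1 (by rw [h]), fun h => h2 (by rw [h])⟩
    · exact absurd h (Fin.castSucc_lt_last _).ne
    · exact absurd h (Fin.castSucc_lt_last _).ne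
  · rintro ⟨h, h1, h2⟩
    exact ⟨Or.inl ⟨fun e => h.ne (Fin.castSucc_injective _ e), a, b, h, rfl, rfl⟩, fun h => h1 (Fin.castSucc_injective _ h),
      fun h => h2 (Fin.castSucc_injective _ h)⟩

theorem dupDelStep_adj_last (b : Fin n) :
    (dupDelStep G u v).Adj (Fin.last n) b.castSucc ↔ EqOrAdj G u b ∧ b ≠ v := by
  simp only [dupDelStep, duplicateVertex, SimpleGraph.deleteIncidenceSet_adj,
    SimpleGraph.sup_adj, SimpleGraph.map_adj', SimpleGraph.fromRel_adj]
  constructor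
  · rintro ⟨⟨_, a', b', h, ha, hb⟩ | ⟨_, ⟨_, w, h, h'⟩ | ⟨h, _⟩⟩, h1, h2⟩
    · exact absurd ha (Fin.castSucc_lt_last _).ne
    · have h := Fin.castSucc_injective _ h
      subst h
      exact ⟨h'.imp_left Eq.symm, fun h => h2 (by rw [h])⟩
    · exact absurd h (Fin.castSucc_lt_last _).ne
  · rintro ⟨h, h2⟩
    exact ⟨Or.inr ⟨(Fin.castSucc_lt_last _).ne', Or.inl ⟨trivial, b, rfl, h.imp_left Eq.symm⟩⟩,
      (Fin.castSucc_lt_last _).ne', fun h => h2 (Fin.castSucc_injective _ h)⟩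

theorem dupDelStep_adj_last' (b : Fin n) :
    (dupDelStep G u v).Adj b.castSucc (Fin.last n) ↔ EqOrAdj G u b ∧ b ≠ v := by
  rw [SimpleGraph.adj_comm, dupDelStep_adj_last]

variable {G}

theorem IsClusterGraph.step (hG : IsClusterGraph G) :
    IsClusterGraph (dupDelStep G u v) := by
  have htr : ∀ a b c, EqOrAdj G a b → EqOrAdj G b c → EqOrAdj G a c := by
    intro a b c h1 h2
    exact (hG.reachable_iff _ _).1
      (((hG.reachable_iff _ _).2 h1).trans ((hG.reachable_iff _ _).2 h2))
  have hsy : ∀ a b, EqOrAdj G a b → EqOrAdj G b a :=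
    fun a b => Or.imp Eq.symm fun h => h.symm
  intro a b c
  refine Fin.lastCases ?_ (fun a => ?_) a <;> refine Fin.lastCases ?_ (fun b => ?_) b <;>
    refine Fin.lastCases ?_ (fun c => ?_) c <;>
    simp only [dupDelStep_adj_castSucc, dupDelStep_adj_last, dupDelStep_adj_last',
      SimpleGraph.irrefl, ne_eq, Fin.castSucc_inj, not_true, false_imp_iff, imp_true_iff]
  · rintro ⟨h1, h2⟩ ⟨h3, h4, h5⟩ _
    exact ⟨htr _ _ _ h1 (Or.inr h3), h5⟩
  · rintro ⟨h1, h2⟩ ⟨h3, h4⟩ h5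
    exact ⟨(htr _ _ _ (hsy _ _ h1) h3).resolve_left h5, h2, h4⟩
  · rintro ⟨h1, h2, h3⟩ ⟨h4, h5⟩ _
    exact ⟨htr _ _ _ h4 (Or.inr h1.symm), h2⟩
  · rintro ⟨h1, h2, h3⟩ ⟨h4, h5, h6⟩ h7
    exact ⟨hG _ _ _ h1 h4 h7, h2, h6⟩

variable (G)

theorem closedDegree_dupDelStep_deleted :
    closedDegree (dupDelStep G u v) v.castSucc = 1 := by
  classical
  rw [closedDegree, Finset.card_eq_one]
  refine ⟨v.castSucc, ?_⟩
  ext b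
  refine Fin.lastCases ?_ (fun b => ?_) b <;>
    simp [EqOrAdj, dupDelStep_adj_castSucc, dupDelStep_adj_last', eq_comm]

theorem sum_ite_eq_sum_ite_and_ne {V : Type*} [Fintype V] [DecidableEq V] (p : V → Prop)
    [DecidablePred p] (v : V) :
    ∑ b, (if p b then 1 else 0)
      = ∑ b, (if p b ∧ b ≠ v then 1 else 0) + (if p v then 1 else 0 : ℕ) := by
  have e : (if p v then 1 else 0 : ℕ) = ∑ b, if b = v then (if p b then 1 else 0) else 0 := by simp
  rw [e, ← Finset.sum_add_distrib]
  refine Finset.sum_congr rfl fun b _ => ?_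
  by_cases hb : b = v <;> simp [hb]

-- A surviving old vertex gains the new vertex when it is equal or adjacent to `u`, and loses `v`
-- when adjacent to it. Placing the loss on the left avoids truncated subtraction.
open scoped Classical in
theorem closedDegree_dupDelStep_castSucc {w : Fin n} (hw : w ≠ v) :
    closedDegree (dupDelStep G u v) w.castSucc + (if EqOrAdj G w v then 1 else 0)
      = closedDegree G w + (if EqOrAdj G w u then 1 else 0) := by
  have h1 : ∀ b : Fin n, EqOrAdj (dupDelStep G u v) w.castSucc b.castSucc
      ↔ EqOrAdj G w b ∧ b ≠ v := by
    intro b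
    rw [EqOrAdj, EqOrAdj, Fin.castSucc_inj, dupDelStep_adj_castSucc]
    constructor
    · rintro (rfl | h)
      exacts [⟨Or.inl rfl, hw⟩, ⟨Or.inr h.1, h.2.2⟩]
    · rintro ⟨rfl | h, h2⟩
      exacts [Or.inl rfl, Or.inr ⟨h, hw, h2⟩]
  have h2 : EqOrAdj (dupDelStep G u v) w.castSucc (Fin.last n) ↔ EqOrAdj G w u := by
    rw [EqOrAdj, EqOrAdj, dupDelStep_adj_last', EqOrAdj, eq_comm (a := u), SimpleGraph.adj_comm]
    simp [(Fin.castSucc_lt_last w).ne, hw]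
  simp only [closedDegree, Finset.card_filter]
  rw [Fin.sum_univ_castSucc, Finset.sum_congr rfl fun b _ => if_congr (h1 b) rfl rfl,
    if_congr h2 rfl rfl, sum_ite_eq_sum_ite_and_ne (fun b => EqOrAdj G w b) v]
  ring

open scoped Classical in
theorem closedDegree_dupDelStep_last :
    closedDegree (dupDelStep G u v) (Fin.last n) + (if EqOrAdj G u v then 1 else 0)
      = closedDegree G u + 1 := by
  have h1 : ∀ b : Fin n, EqOrAdj (dupDelStep G u v) (Fin.last n) b.castSucc
      ↔ EqOrAdj G u b ∧ b ≠ v := by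
    intro b
    rw [EqOrAdj, dupDelStep_adj_last]
    simp [(Fin.castSucc_lt_last b).ne']
  simp only [closedDegree, Finset.card_filter]
  rw [Fin.sum_univ_castSucc, Finset.sum_congr rfl fun b _ => if_congr (h1 b) rfl rfl,
    if_pos (show EqOrAdj _ _ _ from Or.inl rfl), sum_ite_eq_sum_ite_and_ne (fun b => EqOrAdj G u b) v]
  ring

end Step

/-! ### One-step averages and bounded increments -/

section Average

variable {n : ℕ} (G : SimpleGraph (Fin n))

theorem numClosedDegree_eq_sum {V : Type*} [Fintype V] (G : SimpleGraph V) (k : ℕ) :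
    (numClosedDegree G k : ℝ) = ∑ w : V, if closedDegree G w = k then 1 else 0 := by
  rw [numClosedDegree, Finset.card_filter]
  push_cast
  rfl

theorem numClosedDegree_dupDelStep (u v : Fin n) (k : ℕ) :
    (numClosedDegree (dupDelStep G u v) k : ℝ)
      = ∑ w : Fin n, (if closedDegree (dupDelStep G u v) w.castSucc = k then 1 else 0)
        + if closedDegree (dupDelStep G u v) (Fin.last n) = k then 1 else 0 := by
  rw [numClosedDegree_eq_sum, Fin.sum_univ_castSucc]

/-- With s the closed degree of w, the pairs are classified by whether `u` and `v` lie in the closed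
neighbourhood of w. The case v = w is separate, always giving degree 1, so only s - 1 choices of `v`
inside remain. -/
theorem sum_sum_closedDegree_dupDelStep_castSucc (w : Fin n) (k : ℕ) :
    ∑ u : Fin n, ∑ v : Fin n,
        (if closedDegree (dupDelStep G u v) w.castSucc = k then (1 : ℝ) else 0)
      = n * (if 1 = k then 1 else 0)
        + (if closedDegree G w = k then 1 else 0)
          * (((closedDegree G w : ℝ) - 1) * closedDegree G w + ((n : ℝ) - closedDegree G w) ^ 2)
        + (if closedDegree G w = k + 1 then 1 else 0)
          * (((closedDegree G w : ℝ) - 1) * ((n : ℝ) - closedDegree G w))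
        + (if closedDegree G w + 1 = k then 1 else 0)
          * (closedDegree G w * ((n : ℝ) - closedDegree G w)) := by
  classical
  set s := closedDegree G w with hs
  set a : ℝ := if s = k then 1 else 0 with ha
  set b : ℝ := if s = k + 1 then 1 else 0 with hb
  set c : ℝ := if s + 1 = k then 1 else 0 with hc
  set o : ℝ := if 1 = k then 1 else 0 with ho
  -- The first summand treats v = w as an ordinary choice inside the neighbourhood; the second
  -- corrects the value there.
  have hterm : ∀ u v : Fin n,
      (if closedDegree (dupDelStep G u v) w.castSucc = k then (1 : ℝ) else 0)
        = (if EqOrAdj G w v then (if EqOrAdj G w u then a else b)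
            else (if EqOrAdj G w u then c else a))
          + (if v = w then o - (if EqOrAdj G w u then a else b) else 0) := by
    intro u v
    rcases eq_or_ne v w with rfl | hvw
    · rw [closedDegree_dupDelStep_deleted, if_pos (show EqOrAdj G v v from Or.inl rfl)]
      simp [ho]
    · have h := closedDegree_dupDelStep_castSucc G u v hvw.symm
      rw [← hs] at h
      rw [if_neg hvw, add_zero, ha, hb, hc]
      by_cases h1 : EqOrAdj G w v <;> by_cases h2 : EqOrAdj G w u <;>
        simp only [h1, h2, if_true, if_false] at h ⊢ <;> refine if_congr ?_ rfl rfl <;> omega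
  have hsum : ∀ p q : ℝ, ∑ u : Fin n, (if EqOrAdj G w u then p else q)
      = s * p + ((n : ℝ) - s) * q := fun p q => by
    simpa using sum_ite_closedDegree (G := G) w p q
  have hv : ∀ u : Fin n, ∑ v : Fin n,
      (if closedDegree (dupDelStep G u v) w.castSucc = k then (1 : ℝ) else 0)
        = ((s : ℝ) - 1) * (if EqOrAdj G w u then a else b)
          + ((n : ℝ) - s) * (if EqOrAdj G w u then c else a) + o := by
    intro u
    simp_rw [hterm, Finset.sum_add_distrib, hsum]
    rw [Finset.sum_ite_eq' Finset.univ w, if_pos (Finset.mem_univ _)]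
    ring
  simp_rw [hv, Finset.sum_add_distrib, ← Finset.mul_sum, hsum]
  simp only [Finset.sum_const, Finset.card_univ, Fintype.card_fin, nsmul_eq_mul]
  ring

theorem sum_sum_closedDegree_dupDelStep_last (u : Fin n) (k : ℕ) :
    ∑ v : Fin n, (if closedDegree (dupDelStep G u v) (Fin.last n) = k then (1 : ℝ) else 0)
      = (if closedDegree G u = k then 1 else 0) * closedDegree G u
        + (if closedDegree G u + 1 = k then 1 else 0) * ((n : ℝ) - closedDegree G u) := by
  classical
  have hterm : ∀ v : Fin n,
      (if closedDegree (dupDelStep G u v) (Fin.last n) = k then (1 : ℝ) else 0)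
        = if EqOrAdj G u v then (if closedDegree G u = k then 1 else 0)
            else (if closedDegree G u + 1 = k then 1 else 0) := by
    intro v
    have h := closedDegree_dupDelStep_last G u v
    by_cases h1 : EqOrAdj G u v <;> simp only [h1, if_true, if_false] at h ⊢ <;>
      refine if_congr ?_ rfl rfl <;> omega
  simp_rw [hterm]
  rw [sum_ite_closedDegree]
  simp only [Fintype.card_fin]
  ring

theorem sum_sum_numClosedDegree_dupDelStep {k : ℕ} (hk : 1 ≤ k) :
    ∑ u : Fin n, ∑ v : Fin n, (numClosedDegree (dupDelStep G u v) k : ℝ)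
      = (n : ℝ) ^ 2 * (if k = 1 then 1 else 0)
        + numClosedDegree G k * ((k : ℝ) ^ 2 + ((n : ℝ) - k) ^ 2)
        + numClosedDegree G (k + 1) * ((k : ℝ) * ((n : ℝ) - k - 1))
        + numClosedDegree G (k - 1) * ((k : ℝ) * ((n : ℝ) - k + 1)) := by
  simp_rw [numClosedDegree_dupDelStep, Finset.sum_add_distrib,
    sum_sum_closedDegree_dupDelStep_last]
  have hswap : ∑ u : Fin n, ∑ v : Fin n, ∑ w : Fin n,
      (if closedDegree (dupDelStep G u v) w.castSucc = k then (1 : ℝ) else 0)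
      = ∑ w : Fin n, ∑ u : Fin n, ∑ v : Fin n,
        (if closedDegree (dupDelStep G u v) w.castSucc = k then (1 : ℝ) else 0) :=
    (Finset.sum_congr rfl fun u _ => Finset.sum_comm).trans Finset.sum_comm
  rw [hswap]
  simp_rw [sum_sum_closedDegree_dupDelStep_castSucc, Finset.sum_add_distrib]
  have hpred : ∀ w : Fin n, (closedDegree G w + 1 = k) ↔ (closedDegree G w = k - 1) :=
    fun w => by omega
  simp_rw [hpred]
  rw [sum_ite_closedDegree_eq k fun s => ((s : ℝ) - 1) * s + ((n : ℝ) - s) ^ 2,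
    sum_ite_closedDegree_eq (k + 1) fun s => ((s : ℝ) - 1) * ((n : ℝ) - s),
    sum_ite_closedDegree_eq (k - 1) fun s => (s : ℝ) * ((n : ℝ) - s),
    sum_ite_closedDegree_eq k fun s => (s : ℝ),
    sum_ite_closedDegree_eq (k - 1) fun s => (n : ℝ) - s]
  simp only [Finset.sum_const, Finset.card_univ, Fintype.card_fin, nsmul_eq_mul, eq_comm (a := 1)]
  push_cast [Nat.cast_sub hk]
  ring

variable {G}

-- If any such vertex exists, its closed degree is that of `u`, so the whole clique of `u` has at
-- most m vertices.
open scoped Classical in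
theorem IsClusterGraph.card_eqOrAdj_le (hG : IsClusterGraph G) (u : Fin n) (m : ℕ) :
    (Finset.univ.filter fun w => EqOrAdj G w u ∧ closedDegree G w ≤ m).card ≤ m := by
  classical
  rcases Finset.eq_empty_or_nonempty
    (Finset.univ.filter fun w => EqOrAdj G w u ∧ closedDegree G w ≤ m) with h | ⟨w, hw⟩
  · simp [h]
  · simp only [Finset.mem_filter, Finset.mem_univ, true_and] at hw
    refine le_trans (Finset.card_le_card fun x hx => ?_)
      ((hG.closedDegree_eq hw.1).symm.trans_le hw.2)
    simp only [Finset.mem_filter, Finset.mem_univ, true_and] at hx ⊢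
    exact hx.1.imp Eq.symm fun h => h.symm

/-- The status of an old vertex changes only if it is `v` or lies in the clique of `u` or of `v`, of
size at most k + 1. Together with the new vertex this gives 1 + 2 (k + 1) + 1, a bound independent
of n. -/
theorem IsClusterGraph.abs_numClosedDegree_sub_le (hG : IsClusterGraph G) (u v : Fin n) (k : ℕ) :
    |(numClosedDegree (dupDelStep G u v) k : ℝ) - numClosedDegree G k| ≤ 2 * k + 4 := by
  classical
  have hind : ∀ (p : Prop) [Decidable p], |(if p then (1 : ℝ) else 0)| ≤ 1 := by
    intro p _; split_ifs <;> simp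
  have hterm : ∀ w : Fin n, |(if closedDegree (dupDelStep G u v) w.castSucc = k then (1 : ℝ) else 0)
        - (if closedDegree G w = k then 1 else 0)|
      ≤ (if v = w then 1 else 0) + (if EqOrAdj G w u ∧ closedDegree G w ≤ k + 1 then 1 else 0)
        + (if EqOrAdj G w v ∧ closedDegree G w ≤ k + 1 then 1 else 0) := by
    intro w
    have hle1 : |(if closedDegree (dupDelStep G u v) w.castSucc = k then (1 : ℝ) else 0)
        - (if closedDegree G w = k then 1 else 0)| ≤ 1 := by split_ifs <;> simp
    have hnn : ∀ (p : Prop) [Decidable p], 0 ≤ (if p then (1 : ℝ) else 0) := by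
      intro p _; split_ifs <;> simp
    have h1 := hnn (v = w)
    have h2 := hnn (EqOrAdj G w u ∧ closedDegree G w ≤ k + 1)
    have h3 := hnn (EqOrAdj G w v ∧ closedDegree G w ≤ k + 1)
    by_cases hvw : v = w
    · rw [if_pos hvw] at *; linarith
    by_cases hu : EqOrAdj G w u ∧ closedDegree G w ≤ k + 1
    · rw [if_pos hu] at *; linarith
    by_cases hv : EqOrAdj G w v ∧ closedDegree G w ≤ k + 1
    · rw [if_pos hv] at *; linarith
    have h := closedDegree_dupDelStep_castSucc G u v (Ne.symm hvw)
    have hiff : closedDegree (dupDelStep G u v) w.castSucc = k ↔ closedDegree G w = k := by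
      by_cases h4 : EqOrAdj G w v <;> by_cases h5 : EqOrAdj G w u <;>
        simp only [h4, h5, if_true, if_false, true_and, not_le] at h hu hv <;> omega
    rw [if_congr hiff rfl rfl, sub_self, abs_zero]
    linarith
  rw [numClosedDegree_dupDelStep, numClosedDegree_eq_sum G, add_sub_right_comm,
    ← Finset.sum_sub_distrib]
  refine (abs_add_le _ _).trans ?_
  have hsum := (Finset.abs_sum_le_sum_abs _ _).trans
    (Finset.sum_le_sum fun w (_ : w ∈ (Finset.univ : Finset (Fin n))) => hterm w)
  simp only [Finset.sum_add_distrib, Finset.sum_boole] at hsum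
  have c1 : ((Finset.univ.filter fun w => v = w).card : ℝ) ≤ 1 := by
    rw [Finset.filter_eq]; simp
  have c2 : ((Finset.univ.filter fun w => EqOrAdj G w u ∧ closedDegree G w ≤ k + 1).card : ℝ)
      ≤ k + 1 := by exact_mod_cast hG.card_eqOrAdj_le u (k + 1)
  have c3 : ((Finset.univ.filter fun w => EqOrAdj G w v ∧ closedDegree G w ≤ k + 1).card : ℝ)
      ≤ k + 1 := by exact_mod_cast hG.card_eqOrAdj_le v (k + 1)
  have c4 := hind (closedDegree (dupDelStep G u v) (Fin.last n) = k)
  linarith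

end Average

/-! ### Drift and noise along a selection sequence -/

theorem isClusterGraph_dupDelGraph (c : (n : ℕ) → Fin 2 → Fin (n + 1)) (n : ℕ) :
    IsClusterGraph (dupDelGraph c n) := by
  induction n with
  | zero => exact fun _ _ _ h => h.elim
  | succ n ih => exact ih.step _ _

theorem dupDelGraph_congr {c c' : (n : ℕ) → Fin 2 → Fin (n + 1)} {n : ℕ}
    (h : ∀ m < n, c m = c' m) : dupDelGraph c n = dupDelGraph c' n := by
  induction n with
  | zero => rfl
  | succ n ih =>
    rw [dupDelGraph, dupDelGraph, ih fun m hm => h m (by omega), h n (by omega)]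

/-- The mean of the number of vertices of closed degree `k` after one step from `G`. -/
noncomputable def meanNumClosedDegree {n : ℕ} (G : SimpleGraph (Fin n)) (k : ℕ) : ℝ :=
  (∑ u : Fin n, ∑ v : Fin n, (numClosedDegree (dupDelStep G u v) k : ℝ)) / (n : ℝ) ^ 2

/-- The deviation, in step `m + 1`, of the number of vertices of closed degree `k` from its
conditional mean. -/
noncomputable def stepNoise (c : (n : ℕ) → Fin 2 → Fin (n + 1)) (k m : ℕ) : ℝ :=
  numClosedDegree (dupDelGraph c (m + 1)) k - meanNumClosedDegree (dupDelGraph c m) k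

theorem stepNoise_congr {c c' : (n : ℕ) → Fin 2 → Fin (n + 1)} {k m : ℕ}
    (h : ∀ i < m + 1, c i = c' i) : stepNoise c k m = stepNoise c' k m := by
  rw [stepNoise, stepNoise, dupDelGraph_congr h, dupDelGraph_congr fun i hi => h i (by omega)]

theorem IsClusterGraph.abs_meanNumClosedDegree_sub_le {n : ℕ} {G : SimpleGraph (Fin (n + 1))}
    (hG : IsClusterGraph G) (k : ℕ) :
    |meanNumClosedDegree G k - numClosedDegree G k| ≤ 2 * k + 4 := by
  have hn : (0 : ℝ) < ((n + 1 : ℕ) : ℝ) := by positivity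
  have h : meanNumClosedDegree G k - numClosedDegree G k
      = (∑ u : Fin (n + 1), ∑ v : Fin (n + 1),
        ((numClosedDegree (dupDelStep G u v) k : ℝ) - numClosedDegree G k))
          / ((n + 1 : ℕ) : ℝ) ^ 2 := by
    simp only [Finset.sum_sub_distrib, Finset.sum_const, Finset.card_univ, Fintype.card_fin,
      nsmul_eq_mul, meanNumClosedDegree]
    field_simp
  rw [h, abs_div, abs_of_pos (by positivity : 0 < ((n + 1 : ℕ) : ℝ) ^ 2),
    div_le_iff₀ (by positivity)]
  refine (Finset.abs_sum_le_sum_abs _ _).trans ?_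
  refine (Finset.sum_le_card_nsmul _ _ (((n + 1 : ℕ) : ℝ) * (2 * k + 4)) fun u _ => ?_).trans_eq ?_
  · refine (Finset.abs_sum_le_sum_abs _ _).trans ?_
    refine (Finset.sum_le_card_nsmul _ _ (2 * (k : ℝ) + 4) fun v _ =>
      hG.abs_numClosedDegree_sub_le u v k).trans_eq ?_
    simp only [Finset.card_univ, Fintype.card_fin, nsmul_eq_mul]
  · simp only [Finset.card_univ, Fintype.card_fin, nsmul_eq_mul]
    ring

theorem abs_stepNoise_le (c : (n : ℕ) → Fin 2 → Fin (n + 1)) (k m : ℕ) :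
    |stepNoise c k m| ≤ (2 * k + 4) + (2 * k + 4) := by
  have hG := isClusterGraph_dupDelGraph c m
  have h1 := hG.abs_numClosedDegree_sub_le (c m 0) (c m 1) k
  have h2 := hG.abs_meanNumClosedDegree_sub_le k
  rw [stepNoise, dupDelGraph, ← sub_sub_sub_cancel_right _ _ (numClosedDegree (dupDelGraph c m) k : ℝ)]
  exact (abs_sub _ _).trans (add_le_add h1 h2)

/-- The discrepancy consists of the second-order coefficients 2k², k (k + 1) and k (k - 1) over (n +
1)²; each vertex count is at most n + 1, which recovers one factor. -/
theorem abs_meanNumClosedDegree_sub_le_div {n : ℕ} (G : SimpleGraph (Fin (n + 1))) {k : ℕ} (hk : 1 ≤ k) :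
    |meanNumClosedDegree G k - (numClosedDegree G k + (if k = 1 then 1 else 0)
      + k * ((numClosedDegree G (k - 1) : ℝ) + numClosedDegree G (k + 1)
        - 2 * numClosedDegree G k) / ((n : ℝ) + 1))| ≤ 4 * (k : ℝ) ^ 2 / ((n : ℝ) + 1) := by
  have hn : (0 : ℝ) < (n : ℝ) + 1 := by positivity
  have hle : ∀ j, (numClosedDegree G j : ℝ) ≤ (n : ℝ) + 1 := fun j => by
    exact_mod_cast (numClosedDegree_le (G := G) j).trans_eq (Fintype.card_fin _)
  have hk1 : (1 : ℝ) ≤ k := by exact_mod_cast hk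
  rw [meanNumClosedDegree, sum_sum_numClosedDegree_dupDelStep G hk]
  set a : ℝ := (numClosedDegree G k : ℝ)
  set b : ℝ := (numClosedDegree G (k + 1) : ℝ)
  set c : ℝ := (numClosedDegree G (k - 1) : ℝ)
  have h : (((n + 1 : ℕ) : ℝ) ^ 2 * (if k = 1 then 1 else 0)
        + a * ((k : ℝ) ^ 2 + (((n + 1 : ℕ) : ℝ) - k) ^ 2)
        + b * ((k : ℝ) * (((n + 1 : ℕ) : ℝ) - k - 1))
        + c * ((k : ℝ) * (((n + 1 : ℕ) : ℝ) - k + 1))) / ((n + 1 : ℕ) : ℝ) ^ 2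
      - (a + (if k = 1 then 1 else 0) + k * (c + b - 2 * a) / ((n : ℝ) + 1))
      = (2 * k ^ 2 * a - (k * (k + 1) * b + k * (k - 1) * c)) / ((n : ℝ) + 1) ^ 2 := by
    push_cast
    field_simp
    ring
  rw [h, abs_div, abs_of_pos (by positivity : 0 < ((n : ℝ) + 1) ^ 2),
    div_le_div_iff₀ (by positivity) hn]
  have ha := hle k
  have hb := hle (k + 1)
  have hc := hle (k - 1)
  have ha0 : 0 ≤ a := Nat.cast_nonneg _
  have hb0 : 0 ≤ b := Nat.cast_nonneg _
  have hc0 : 0 ≤ c := Nat.cast_nonneg _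
  have hkm : 0 ≤ (k : ℝ) - 1 := by linarith
  have hbound : |2 * (k : ℝ) ^ 2 * a - (k * (k + 1) * b + k * (k - 1) * c)|
      ≤ 4 * k ^ 2 * ((n : ℝ) + 1) := by
    have e1 : 2 * (k : ℝ) ^ 2 * a ≤ 2 * k ^ 2 * ((n : ℝ) + 1) := by gcongr
    have e2 : (k : ℝ) * (k + 1) * b ≤ k * (k + 1) * ((n : ℝ) + 1) := by gcongr
    have e3 : (k : ℝ) * (k - 1) * c ≤ k * (k - 1) * ((n : ℝ) + 1) := by gcongr
    have p1 : 0 ≤ 2 * (k : ℝ) ^ 2 * a := by positivity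
    have p2 : 0 ≤ (k : ℝ) * (k + 1) * b := by positivity
    have p3 : 0 ≤ (k : ℝ) * (k - 1) * c := by positivity
    have p4 : 0 ≤ (k : ℝ) ^ 2 * ((n : ℝ) + 1) := by positivity
    rw [abs_le]
    constructor <;> linarith
  calc _ ≤ 4 * (k : ℝ) ^ 2 * ((n : ℝ) + 1) * ((n : ℝ) + 1) := by gcongr
    _ = _ := by ring

/-! ### Independence of the past and orthogonality of the noise -/

/-- A martingale-difference property without conditional expectations: split over the finitely many
values of Z, factor each integral by independence, and use that all values have the same probability
p. -/
theorem integral_eq_zero_of_indepFun {Ω α β : Type*} [MeasurableSpace Ω] [MeasurableSpace α]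
    [MeasurableSpace β] [Fintype β] [MeasurableSingletonClass β] {μ : Measure Ω}
    [IsProbabilityMeasure μ] {H : Ω → α} {Z : Ω → β} {Ψ : α → β → ℝ} {B p : ℝ}
    (hind : IndepFun H Z μ) (hH : Measurable H) (hZ : Measurable Z)
    (hΨ : ∀ z, Measurable fun h => Ψ h z) (hB : ∀ h z, |Ψ h z| ≤ B)
    (hp : ∀ z, μ.real (Z ⁻¹' {z}) = p) (h0 : ∀ h, ∑ z, Ψ h z = 0) :
    ∫ ω, Ψ (H ω) (Z ω) ∂μ = 0 := by
  classical
  have hm : ∀ z, Measurable fun ω => Ψ (H ω) z := fun z => (hΨ z).comp hH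
  have hint : ∀ z, Integrable (fun ω => Ψ (H ω) z) μ := fun z =>
    Integrable.of_bound (hm z).aestronglyMeasurable B (Eventually.of_forall fun ω => hB _ _)
  have hsplit : ∀ ω, Ψ (H ω) (Z ω)
      = ∑ z, Set.indicator (Z ⁻¹' {z}) (fun ω => Ψ (H ω) z) ω := by
    intro ω
    simp [Set.indicator_apply]
  have hZm : ∀ z, MeasurableSet (Z ⁻¹' {z}) := fun z => hZ (measurableSet_singleton z)
  have hterm : ∀ z, ∫ ω, Set.indicator (Z ⁻¹' {z}) (fun ω => Ψ (H ω) z) ω ∂μ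
      = (∫ ω, Ψ (H ω) z ∂μ) * p := by
    intro z
    have hind' : IndepFun (fun ω => Ψ (H ω) z)
        (fun ω => Set.indicator {z} (fun _ => (1 : ℝ)) (Z ω)) μ :=
      hind.comp (hΨ z) (measurable_const.indicator (measurableSet_singleton z))
    have hI : Measurable fun ω => Set.indicator {z} (fun _ => (1 : ℝ)) (Z ω) :=
      (measurable_const.indicator (measurableSet_singleton z)).comp hZ
    have := hind'.integral_fun_mul_eq_mul_integral (hm z).aestronglyMeasurable
      hI.aestronglyMeasurable
    have h2 : ∫ ω, Set.indicator {z} (fun _ => (1 : ℝ)) (Z ω) ∂μ = p := by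
      rw [← hp z, ← integral_indicator_one (hZm z)]
      rfl
    rw [h2] at this
    rw [← this]
    refine integral_congr_ae (Eventually.of_forall fun ω => ?_)
    by_cases h : Z ω = z <;> simp [h]
  simp_rw [hsplit]
  rw [integral_finsetSum _ fun z _ => (hint z).indicator (hZm z)]
  simp_rw [hterm]
  rw [← Finset.sum_mul, ← integral_finsetSum _ fun z _ => hint z]
  simp [h0]

/-- The indices of the selections in the first `j` steps. -/
abbrev pastIndices (j : ℕ) : Finset (ℕ × Fin 2) := Finset.range j ×ˢ Finset.univ

/-- The selections in the first `j` steps, extended arbitrarily to all steps. -/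
def extendSelection {j : ℕ} (h : (p : pastIndices j) → Fin (p.1.1 + 1)) (m : ℕ) (i : Fin 2) :
    Fin (m + 1) :=
  if hm : (m, i) ∈ pastIndices j then h ⟨(m, i), hm⟩ else 0

section Random

variable {Ω : Type*} {C : (n : ℕ) → Fin 2 → Ω → Fin (n + 1)}

/-- The random selections in the first `j` steps. -/
def pastSelection (C : (n : ℕ) → Fin 2 → Ω → Fin (n + 1)) (j : ℕ) (ω : Ω)
    (p : pastIndices j) : Fin (p.1.1 + 1) :=
  C p.1.1 p.1.2 ω

theorem extendSelection_pastSelection {j m : ℕ} (hm : m < j) (ω : Ω) :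
    (fun i => C m i ω) = extendSelection (pastSelection C j ω) m := by
  ext i
  simp [extendSelection, pastSelection, hm]

theorem stepNoise_eq_past {j m : ℕ} (hm : m < j) (k : ℕ) (ω : Ω) :
    stepNoise (fun m i => C m i ω) k m
      = stepNoise (extendSelection (pastSelection C j ω)) k m :=
  stepNoise_congr fun _ hi => extendSelection_pastSelection (by omega) ω

variable [MeasurableSpace Ω] {μ : Measure Ω}

theorem IsUniformSelection.measurable_pastSelection (hC : IsUniformSelection μ C) (j : ℕ) :
    Measurable (pastSelection C j) :=
  measurable_pi_lambda _ fun p => hC.measurable p.1.1 p.1.2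

theorem IsUniformSelection.measurable_stepNoise (hC : IsUniformSelection μ C) (k m : ℕ) :
    Measurable fun ω => stepNoise (fun m i => C m i ω) k m := by
  simp_rw [stepNoise_eq_past (Nat.lt_succ_self m)]
  exact (measurable_of_finite fun h => stepNoise (extendSelection h) k m).comp
    (hC.measurable_pastSelection _)

theorem IsUniformSelection.measureReal_pair (hC : IsUniformSelection μ C) [IsProbabilityMeasure μ]
    (j : ℕ) (z : Fin (j + 1) × Fin (j + 1)) :
    μ.real ((fun ω => (C j 0 ω, C j 1 ω)) ⁻¹' {z}) = (1 / ((j : ℝ) + 1)) * (1 / ((j : ℝ) + 1)) := by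
  have hind : IndepFun (C j 0) (C j 1) μ :=
    hC.indep.indepFun (i := (j, 0)) (j := (j, 1)) (by simp)
  have h := hind.measure_inter_preimage_eq_mul {z.1} {z.2} (measurableSet_singleton _)
    (measurableSet_singleton _)
  have hu : ∀ i a, μ.real (C j i ⁻¹' {a}) = 1 / ((j : ℝ) + 1) := by
    intro i a
    have := hC.uniform j i a
    rw [Measure.real, show C j i ⁻¹' {a} = {ω | C j i ω = a} from rfl, this]
    rw [ENNReal.toReal_div, ENNReal.toReal_add (by simp) (by simp)]
    simp
  have hpre : (fun ω => (C j 0 ω, C j 1 ω)) ⁻¹' {z} = C j 0 ⁻¹' {z.1} ∩ C j 1 ⁻¹' {z.2} := by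
    ext ω
    simp [Prod.ext_iff]
  rw [hpre, Measure.real, h, ENNReal.toReal_mul]
  exact congrArg₂ (· * ·) (hu 0 z.1) (hu 1 z.2)

theorem IsUniformSelection.indepFun_past (hC : IsUniformSelection μ C) (j : ℕ) :
    IndepFun (pastSelection C j) (fun ω => (C j 0 ω, C j 1 ω)) μ := by
  have hdisj : Disjoint (pastIndices j) {(j, 0), (j, 1)} := by
    rw [Finset.disjoint_left]
    intro p hp hp'
    simp only [pastIndices, Finset.mem_product, Finset.mem_range, Finset.mem_insert,
      Finset.mem_singleton] at hp hp'
    rcases hp' with rfl | rfl <;> simp at hp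
  have h := hC.indep.indepFun_finset (pastIndices j) {(j, 0), (j, 1)} hdisj
    fun p => hC.measurable p.1 p.2
  have hφ : Measurable fun z : ((p : ({(j, 0), (j, 1)} : Finset (ℕ × Fin 2))) → Fin (p.1.1 + 1)) =>
      ((z ⟨(j, 0), by simp⟩, z ⟨(j, 1), by simp⟩) : Fin (j + 1) × Fin (j + 1)) :=
    measurable_of_finite _
  exact h.comp measurable_id hφ

/-- The noise of step i and the graph before step j are functions of the past, while the pair
selected in step j is uniform and independent of it; summed over all pairs, the deviation from the
mean is zero. -/
theorem IsUniformSelection.integral_stepNoise_mul (hC : IsUniformSelection μ C)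
    [IsProbabilityMeasure μ] (k : ℕ) {i j : ℕ} (hij : i < j) :
    ∫ ω, stepNoise (fun m i => C m i ω) k i * stepNoise (fun m i => C m i ω) k j ∂μ = 0 := by
  set Ψ : ((p : pastIndices j) → Fin (p.1.1 + 1)) → Fin (j + 1) × Fin (j + 1) → ℝ :=
    fun h z => stepNoise (extendSelection h) k i
      * (numClosedDegree (dupDelStep (dupDelGraph (extendSelection h) j) z.1 z.2) k
        - meanNumClosedDegree (dupDelGraph (extendSelection h) j) k) with hΨ
  have heq : ∀ ω, stepNoise (fun m i => C m i ω) k i * stepNoise (fun m i => C m i ω) k j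
      = Ψ (pastSelection C j ω) (C j 0 ω, C j 1 ω) := by
    intro ω
    have e : stepNoise (fun m i => C m i ω) k j
        = numClosedDegree (dupDelStep (dupDelGraph (fun m i => C m i ω) j) (C j 0 ω) (C j 1 ω)) k
          - meanNumClosedDegree (dupDelGraph (fun m i => C m i ω) j) k := rfl
    rw [stepNoise_eq_past hij, e,
      dupDelGraph_congr fun m hm => extendSelection_pastSelection (C := C) hm ω]
  simp_rw [heq]
  -- The history and the selected pair take finitely many values, so boundedness is automatic, as is
  -- measurability in the history.
  obtain ⟨B, hB⟩ := (Set.finite_range fun q : _ × _ => |Ψ q.1 q.2|).bddAbove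
  refine integral_eq_zero_of_indepFun (B := B) (hC.indepFun_past j) (hC.measurable_pastSelection j)
    ((hC.measurable j 0).prodMk (hC.measurable j 1)) (fun z => measurable_of_finite _)
    (fun h z => hB ⟨(h, z), rfl⟩) (hC.measureReal_pair j) fun h => ?_
  rw [hΨ, ← Finset.mul_sum, Finset.sum_sub_distrib, Fintype.sum_prod_type]
  simp only [Finset.sum_const, Finset.card_univ, Fintype.card_prod, Fintype.card_fin, nsmul_eq_mul,
    meanNumClosedDegree]
  have : (((j + 1 : ℕ) : ℝ)) ≠ 0 := by positivity
  rw [Nat.cast_mul, ← sq, mul_div_cancel₀ _ (pow_ne_zero 2 this), sub_self, mul_zero]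

theorem IsUniformSelection.ae_tendsto_numClosedDegree (hC : IsUniformSelection μ C)
    [IsProbabilityMeasure μ] :
    ∀ᵐ ω ∂μ, ∀ k, Tendsto (fun n : ℕ =>
      (numClosedDegree (dupDelGraph (fun m i => C m i ω) n) k : ℝ) / ((n : ℝ) + 1))
        atTop (𝓝 (boundedSol k)) := by
  have hnoise : ∀ᵐ ω ∂μ, ∀ k, Tendsto (fun n : ℕ =>
      (∑ m ∈ Finset.range n, stepNoise (fun m i => C m i ω) k m) / (n : ℝ)) atTop (𝓝 0) :=
    ae_all_iff.2 fun k => ae_tendsto_sum_div_of_orthogonal (hC.measurable_stepNoise k)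
      (fun n ω => abs_stepNoise_le _ k n) fun i j hij => hC.integral_stepNoise_mul k hij
  filter_upwards [hnoise] with ω hω
  set G := dupDelGraph fun m i => C m i ω with hG
  refine tendsto_div_of_noisy_recursion (C := 1) (K := fun k => 4 * (k : ℝ) ^ 2)
    (X := fun k n => (numClosedDegree (G n) k : ℝ))
    (e := fun k n => meanNumClosedDegree (G n) k
      - (numClosedDegree (G n) k + (if k = 1 then 1 else 0)
        + k * ((numClosedDegree (G n) (k - 1) : ℝ) + numClosedDegree (G n) (k + 1)
          - 2 * numClosedDegree (G n) k) / ((n : ℝ) + 1)))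
    (ξ := fun k n => stepNoise (fun m i => C m i ω) k n)
    boundedSol_zero (fun k => ?_) (fun k hk => boundedSol_eq hk) (fun n => ?_) (fun k n => ?_)
    (fun k n _ => ?_) (fun k n hk => abs_meanNumClosedDegree_sub_le_div _ hk) fun k _ => hω k
  · rcases Nat.eq_zero_or_pos k with rfl | hk
    · simp [boundedSol_zero]
    · rw [abs_of_pos (boundedSol_pos hk)]
      exact boundedSol_le_one k
  · simp [numClosedDegree_zero]
  · rw [abs_of_nonneg (Nat.cast_nonneg _)]
    exact_mod_cast (numClosedDegree_le (G := G n) k).trans_eq (Fintype.card_fin _)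
  · simp only [stepNoise, ← hG]
    ring

end Random

/-! ### Passage from vertex counts to clique counts -/

theorem mainTheorem2 :
    ∃ y : ℕ → ℝ,
      (∀ k : ℕ, 1 ≤ k → 0 < y k) ∧
      y 1 = (1 + 2 * y 2) / 3 ∧
      (∀ k : ℕ, 2 ≤ k →
        y k = (((k : ℝ) - 1) * y (k - 1) + ((k : ℝ) + 1) * y (k + 1)) / (2 * (k : ℝ) + 1)) ∧
      ∀ (Ω : Type*) [MeasurableSpace Ω] (μ : Measure Ω) [IsProbabilityMeasure μ]
        (C : (n : ℕ) → Fin 2 → Ω → Fin (n + 1)), IsUniformSelection μ C →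
        (∀ (ω : Ω) (n : ℕ), IsDisjointUnionOfCliques (dupDelGraph (fun m i => C m i ω) n)) ∧
        ∀ k : ℕ, 1 ≤ k → ∀ᵐ ω ∂μ,
          Tendsto (fun n : ℕ => (numCliques (dupDelGraph (fun m i => C m i ω) n) k : ℝ) / (n : ℝ))
            atTop (𝓝 (y k)) := by
  refine ⟨fun k => boundedSol k / k, fun k hk => ?_, ?_, fun k hk => ?_,
    fun Ω _ μ _ C hC => ⟨fun ω n => (isClusterGraph_dupDelGraph _ n).isDisjointUnionOfCliques,
      fun k hk => ?_⟩⟩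
  · exact div_pos (boundedSol_pos hk) (by exact_mod_cast hk)
  · have := boundedSol_one
    norm_num
    linarith
  · obtain ⟨k, rfl⟩ : ∃ j, k = j + 2 := ⟨k - 2, by omega⟩
    have h := boundedSol_eq (k := k + 2) (by omega)
    rw [if_neg (by omega), show k + 2 - 1 = k + 1 by omega] at h
    rw [show k + 2 - 1 = k + 1 by omega]
    push_cast at h ⊢
    have hk1 : (0 : ℝ) < (k : ℝ) + 1 := by positivity
    have hk3 : (0 : ℝ) < (k : ℝ) + 2 + 1 := by positivity
    have e1 : ((k : ℝ) + 2 - 1) * (boundedSol (k + 1) / ((k : ℝ) + 1)) = boundedSol (k + 1) := by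
      field_simp; ring
    have e2 : ((k : ℝ) + 2 + 1) * (boundedSol (k + 2 + 1) / ((k : ℝ) + 2 + 1))
        = boundedSol (k + 2 + 1) := by
      field_simp
    rw [e1, e2, div_eq_div_iff (by positivity) (by positivity)]
    linarith
  · filter_upwards [hC.ae_tendsto_numClosedDegree] with ω hω
    have hk0 : (0 : ℝ) < k := by exact_mod_cast hk
    -- The factor (n + 1) / n converts the normalisation by the number of vertices into that by the
    -- number of steps.
    have h1 : Tendsto (fun n : ℕ => 1 + 1 / (n : ℝ)) atTop (𝓝 1) := by
      simpa using (tendsto_one_div_atTop_nhds_zero_nat (𝕜 := ℝ)).const_add 1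
    have h2 := ((hω k).mul h1).div_const (k : ℝ)
    rw [mul_one] at h2
    refine h2.congr' ?_
    filter_upwards [eventually_ge_atTop 1] with n hn
    have hn0 : (0 : ℝ) < n := by exact_mod_cast hn
    rw [← (isClusterGraph_dupDelGraph _ n).numCliques_mul k]
    push_cast
    field_simp
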